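/- For a square-free positive integer $n$, let $U_n = \operatorname{Spec}(\mathbb{Z}[1/n])$ and let $\pi_A^t(U_n)$ be the set of finite groups (up to isomorphism) that occur as $\operatorname{Gal}(K/\mathbb{Q})$ for a finite Galois extension $K/\mathbb{Q}$ that is unramified at every finite prime not dividing $n$ and tame, that is, for every prime number $p$ and every prime $P$ of $\mathcal{O}_K$ above $p$, the ramification index $e(P|p)$ is not divisible by $p$ (no condition is imposed at the infinite place). For a finite group $G$, let $d(G)$ be the minimal cardinality of a generating set of $G$, and let $\log$ denote the natural logarithm. **Proposition.** For every square-free positive integer $n$ and every nilpotent group $G \in \pi_A^t(U_n)$, one has $d(G) \leq \log(n)$. (That is, the bound $d(G) \le \log(n) + C$ conjectured by Harbater for all $G\in\pi_A^t(U_n)$ holds for nilpotent $G$ with $C = 0$.) -/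

import Mathlib

open scoped NumberField

/-- The number field `K` is unramified at every finite prime not dividing `n`
(no condition at the infinite places). -/
def UnramifiedOutside (K : Type) [Field K] [NumberField K] (n : ℕ) : Prop :=
  ∀ p : ℕ, p.Prime → ¬ p ∣ n → Algebra.IsUnramifiedIn (𝓞 K) (Ideal.span {(p : ℤ)})

/-- The number field `K` is tame over `ℚ`: for every prime number `p` and every prime `P` of `𝓞 K`
over `p`, the ramification index of `P` over `ℤ` is not divisible by `p`. (Residue fields are
finite, so their extensions are automatically separable. No condition at the infinite places.) -/
def IsTameOverRat (K : Type) [Field K] [NumberField K] : Prop :=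
  ∀ p : ℕ, p.Prime → ∀ P : Ideal (𝓞 K), P.IsPrime → P.LiesOver (Ideal.span {(p : ℤ)}) →
    ¬ p ∣ Ideal.ramificationIdx P ℤ

/-- Membership of `G` in `π_A^t(U_n)`, where `U_n = Spec ℤ[1/n]`: the group `G` is isomorphic to
the Galois group of a finite tame Galois extension of `ℚ` that is unramified at all finite primes
not dividing `n`. (Every number field is isomorphic to one whose type lives in `Type`.) -/
def IsTameGaloisGroup (n : ℕ) (G : Type*) [Group G] : Prop :=
  ∃ (K : Type) (_ : Field K) (_ : NumberField K),
    IsGalois ℚ K ∧ UnramifiedOutside K n ∧ IsTameOverRat K ∧ Nonempty (G ≃* (K ≃ₐ[ℚ] K))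

/-!
Let `K/ℚ` be tame and Galois with nilpotent group `G`, unramified outside `n`. The bound comes from
showing that `G` is generated by one element for each odd prime dividing `n`; as `log p ≥ 1` for
`p ≥ 3`, the number of these primes is at most `∑ log p ≤ log n`.

* By Minkowski's theorem `ℚ` has no proper extension unramified at all finite primes, so `G` is
  generated by the inertia groups of the primes of `𝓞 K` (`eq_top_of_inertia_le`).
* The inertia group `I` of `P` acts on the line `P / P ^ 2` over `𝓞 K / P`, which gives a character
  `I → 𝓞 K / P`. An automorphism in its kernel acts trivially on all the graded pieces
  `P ^ k / P ^ (k + 1)`, and if its order is prime to the residue characteristic it must then be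
  trivial (`eq_one_of_smul_sub_mem_sq`). So tame inertia embeds in the units of a field and is
  cyclic (`isCyclic_inertia`).
* Comparing the characters of `σ` and of its conjugate by a Frobenius element `τ` gives
  `τ σ τ⁻¹ = σ ^ q`, where `q` is the size of the residue field below
  (`conj_eq_pow_of_isArithFrobAt`). For `q = 2` this says that `σ` is the commutator of `τ` and `σ`.
  Thus the prime `2`, for which `log 2 < 1`, contributes nothing to the abelianization of `G`
  (`inertia_le_commutator_of_liesOver_two`).
* Inertia groups of primes over the same `p` are conjugate, so modulo commutators the group `G` is
  generated by one element for each odd `p ∣ n`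
  (`exists_finset_closure_sup_commutator_eq_top`). In a finite nilpotent group the commutator
  subgroup lies in the Frattini subgroup, so these elements generate `G` itself
  (`rank_le_card_of_closure_sup_commutator`).
-/

open scoped Pointwise

/-! ### The tame character of the inertia group -/

section TameInertia

variable {B G : Type*} [CommRing B] [Group G] [MulSemiringAction G B] {P : Ideal B} {σ : G}

theorem smul_mem_pow_of_mem_inertia (hσ : σ ∈ P.inertia G) {k : ℕ} {a : B} (ha : a ∈ P ^ k) :
    σ • a ∈ P ^ k := by
  have hP : σ • P = P := Ideal.inertia_le_stabilizer P hσ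
  rw [← hP, ← smul_pow']
  exact Ideal.smul_mem_pointwise_smul σ a _ ha

/-- If `σ` acts trivially on `B / P` and on `P / P ^ 2`, then it acts trivially on every
`P ^ k / P ^ (k + 1)`, since `P ^ k` is generated by products of `k` elements of `P`. -/
theorem smul_sub_mem_pow_succ (hσ : σ ∈ P.inertia G) (h : ∀ a ∈ P, σ • a - a ∈ P ^ 2)
    (k : ℕ) : ∀ b ∈ P ^ k, σ • b - b ∈ P ^ (k + 1) := by
  induction k with
  | zero => intro b _; simpa using hσ b
  | succ k ih =>
    intro b hb
    rw [pow_succ'] at hb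
    induction hb using Submodule.mul_induction_on' with
    | mem_mul_mem a ha c hc =>
      have e : σ • (a * c) - a * c = (σ • a - a) * σ • c + a * (σ • c - c) := by
        rw [smul_mul']; ring
      rw [e]
      refine add_mem ?_ ?_
      · rw [show k + 1 + 1 = 2 + k by ring, pow_add]
        exact Ideal.mul_mem_mul (h a ha) (smul_mem_pow_of_mem_inertia hσ hc)
      · rw [pow_succ' P (k + 1)]
        exact Ideal.mul_mem_mul ha (ih c hc)
    | add x _ y _ hx hy =>
      rw [smul_add, add_sub_add_comm]
      exact add_mem hx hy

/-- The absence of wild inertia. By Krull's intersection theorem it is enough to show by induction on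
`k` that `σ` acts trivially on `B / P ^ k`. -/
theorem eq_one_of_smul_sub_mem_sq [IsDomain B] [IsNoetherianRing B] [FaithfulSMul G B]
    [P.IsMaximal] (hσ : σ ∈ P.inertia G) (h : ∀ a ∈ P, σ • a - a ∈ P ^ 2)
    (hm : (orderOf σ : B) ∉ P) : σ = 1 := by
  have key (k : ℕ) : ∀ x : B, σ • x - x ∈ P ^ k := by
    induction k with
    | zero => simp
    | succ k ih =>
      intro x
      -- `σ` fixes `σ • x - x ∈ P ^ k` modulo `P ^ (k + 1)`, so `σ ^ j` translates `x` by
      -- `j * (σ • x - x)`; the order of `σ`, a unit modulo `P`, then kills `σ • x - x`.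
      have hpow (j : ℕ) : σ ^ j • x - x - j * (σ • x - x) ∈ P ^ (k + 1) := by
        induction j with
        | zero => simp
        | succ j hj =>
          have e : σ ^ (j + 1) • x - x - ((j + 1 : ℕ) : B) * (σ • x - x) =
              σ • (σ ^ j • x - x - j * (σ • x - x))
                + j * (σ • (σ • x - x) - (σ • x - x)) := by
            have : σ • (j : B) = j := map_natCast (MulSemiringAction.toRingHom G B σ) j
            rw [pow_succ', mul_smul, smul_sub, smul_sub, smul_mul', this]
            push_cast
            ring
          rw [e]
          exact add_mem (smul_mem_pow_of_mem_inertia hσ hj)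
            (Ideal.mul_mem_left _ _ (smul_sub_mem_pow_succ hσ h k _ (ih x)))
      have := hpow (orderOf σ)
      rw [pow_orderOf_eq_one, one_smul, sub_self, zero_sub, neg_mem_iff] at this
      exact (Ideal.IsMaximal.mul_mem_pow P this).resolve_left hm
  refine FaithfulSMul.eq_of_smul_eq_smul (α := B) fun x ↦ ?_
  rw [one_smul, ← sub_eq_zero, ← Ideal.mem_bot,
    ← Ideal.iInf_pow_eq_bot_of_isDomain P Ideal.IsPrime.ne_top', Ideal.mem_iInf]
  exact fun k ↦ key k x

/-- `θ` is the character of the inertia group of `P` giving its action on the line `P / P ^ 2`: the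
value `θ σ` is the class of `u` exactly when `σ` acts on `P / P ^ 2` as multiplication by `u`. -/
def IsTameCharacter (θ : P.inertia G →* B ⧸ P) : Prop :=
  ∀ (σ : P.inertia G) (u : B),
    (∀ a ∈ P, σ • a - u * a ∈ P ^ 2) ↔ θ σ = Ideal.Quotient.mk P u

variable (G P) in
/-- The ideal `P` has no wild inertia in `G`: the order of each element of the inertia group is
prime to the residue characteristic, expressed as the order not lying in `P`. -/
def HasTameInertia : Prop := ∀ σ ∈ P.inertia G, (orderOf σ : B) ∉ P

variable [IsDedekindDomain B] [P.IsPrime]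

/-- The element `σ` acts on the line `P / P ^ 2` as multiplication by a scalar. -/
theorem exists_smul_sub_mul_mem_sq (hP : P ≠ ⊥) (hσ : σ ∈ P.inertia G) :
    ∃ u : B, ∀ a ∈ P, σ • a - u * a ∈ P ^ 2 := by
  obtain ⟨π, hπ, hπ2⟩ := SetLike.exists_of_lt (Ideal.pow_succ_lt_pow hP 1)
  obtain ⟨u, e, he, hu⟩ := Ideal.exists_mul_add_mem_pow_succ hP π (σ • π) hπ hπ2
    (smul_mem_pow_of_mem_inertia hσ hπ)
  refine ⟨u, fun a ha ↦ ?_⟩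
  obtain ⟨d, f, hf, rfl⟩ := Ideal.exists_mul_add_mem_pow_succ hP π a hπ hπ2 (by simpa using ha)
  have hd : (σ • d - d) * (σ • π) ∈ P ^ (1 + 1) := by
    rw [pow_succ']
    exact Ideal.mul_mem_mul (hσ d) (smul_mem_pow_of_mem_inertia hσ hπ)
  have e1 : σ • (π * d + f) - u * (π * d + f) =
      (σ • d - d) * σ • π + d * e + σ • f - u * f := by
    rw [smul_add, smul_mul', ← hu]; ring
  rw [e1]
  exact sub_mem (add_mem (add_mem hd (Ideal.mul_mem_left _ _ he))
    (smul_mem_pow_of_mem_inertia hσ hf)) (Ideal.mul_mem_left _ _ hf)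

/-- The scalar by which a map acts on `P / P ^ 2` is unique modulo `P`. -/
theorem mk_eq_mk_of_sub_mul_mem_sq (hP : P ≠ ⊥) {u v : B} {s : B → B}
    (hu : ∀ a ∈ P, s a - u * a ∈ P ^ 2) (hv : ∀ a ∈ P, s a - v * a ∈ P ^ 2) :
    Ideal.Quotient.mk P u = Ideal.Quotient.mk P v := by
  obtain ⟨π, hπ, hπ2⟩ := SetLike.exists_of_lt (Ideal.pow_succ_lt_pow hP 1)
  rw [pow_one] at hπ
  refine Ideal.Quotient.eq.mpr (Ideal.mem_prime_of_mul_mem_pow hP hπ2 ?_)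
  convert! sub_mem (hv π hπ) (hu π hπ) using 1
  ring

variable (G) in
theorem exists_tameCharacter (hP : P ≠ ⊥) :
    ∃ θ : P.inertia G →* B ⧸ P, IsTameCharacter θ := by
  choose u hu using fun σ : P.inertia G ↦ exists_smul_sub_mul_mem_sq hP σ.2
  refine ⟨⟨⟨fun σ ↦ Ideal.Quotient.mk P (u σ), ?_⟩, fun σ τ ↦ ?_⟩,
    fun σ v ↦ ⟨fun h ↦ ?_, fun h ↦ ?_⟩⟩
  · rw [← map_one (Ideal.Quotient.mk P)]
    exact mk_eq_mk_of_sub_mul_mem_sq hP (hu 1) (by simp)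
  · dsimp only
    rw [← map_mul]
    refine mk_eq_mk_of_sub_mul_mem_sq hP (hu (σ * τ)) fun a ha ↦ ?_
    have hτ : (τ : G) • a ∈ P := by
      simpa using smul_mem_pow_of_mem_inertia τ.2 (k := 1) (by simpa using ha)
    have e : ((σ * τ : P.inertia G) : G) • a - u σ * u τ * a =
        ((σ : G) • (τ : G) • a - u σ * (τ : G) • a) + u σ * ((τ : G) • a - u τ * a) := by
      rw [Subgroup.coe_mul, mul_smul]; ring
    rw [e]
    exact add_mem (hu σ _ hτ) (Ideal.mul_mem_left _ _ (hu τ a ha))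
  · exact mk_eq_mk_of_sub_mul_mem_sq hP (hu σ) h
  · intro a ha
    have : (u σ - v) * a ∈ P ^ 2 := by
      rw [pow_two]; exact Ideal.mul_mem_mul (Ideal.Quotient.eq.mp h) ha
    convert! add_mem (hu σ a ha) this using 1
    rw [Subgroup.smul_def]; ring

variable [FaithfulSMul G B]

theorem IsTameCharacter.injective {θ : P.inertia G →* B ⧸ P} (hθ : IsTameCharacter θ)
    (hP : P ≠ ⊥) (ht : HasTameInertia G P) : Function.Injective θ := by
  have : P.IsMaximal := ‹P.IsPrime›.isMaximal hP
  refine (injective_iff_map_eq_one θ).mpr fun σ h ↦ Subtype.ext ?_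
  refine eq_one_of_smul_sub_mem_sq σ.2 ?_ (ht σ σ.2)
  simpa [Subgroup.smul_def] using (hθ σ 1).mpr (by simpa using h)

theorem isCyclic_inertia [Finite G] (hP : P ≠ ⊥) (ht : HasTameInertia G P) :
    IsCyclic (P.inertia G) := by
  obtain ⟨θ, hθ⟩ := exists_tameCharacter G hP
  exact isCyclic_of_injective_ringHom θ (hθ.injective hP ht)

/-- A Frobenius element acts on tame inertia by raising to the power of the size of the residue
field below: if `σ` acts on `P / P ^ 2` as `u`, then its conjugate acts as `τ • u ≡ u ^ q`. -/
theorem conj_eq_pow_of_isArithFrobAt {A : Type*} [CommRing A] [Algebra A B] [SMulCommClass G A B]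
    (hP : P ≠ ⊥) (ht : HasTameInertia G P) {τ : G}
    (hτ : IsArithFrobAt A τ P) (hσ : σ ∈ P.inertia G) :
    τ * σ * τ⁻¹ = σ ^ Nat.card (A ⧸ P.under A) := by
  obtain ⟨θ, hθ⟩ := exists_tameCharacter G hP
  have hτP : τ • P = P := hτ.mem_stabilizer
  have hτP' : τ⁻¹ • P = P := inv_smul_eq_iff.mpr hτP.symm
  have hc : τ * σ * τ⁻¹ ∈ P.inertia G := fun x ↦ by
    have := Ideal.smul_mem_pointwise_smul τ _ _ (hσ (τ⁻¹ • x))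
    rw [hτP, smul_sub, smul_inv_smul] at this
    simpa only [mul_smul, Submodule.mem_toAddSubgroup] using this
  obtain ⟨u, hu⟩ := exists_smul_sub_mul_mem_sq hP hσ
  have h1 : θ ⟨_, hc⟩ = Ideal.Quotient.mk P (τ • u) := by
    refine (hθ _ _).mp fun a ha ↦ ?_
    have ha' : τ⁻¹ • a ∈ P := by
      rw [← hτP']; exact Ideal.smul_mem_pointwise_smul _ _ _ ha
    have := Ideal.smul_mem_pointwise_smul τ _ _ (hu _ ha')
    rw [smul_pow', hτP, smul_sub, smul_mul', smul_inv_smul] at this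
    simpa only [Subgroup.smul_def, mul_smul] using this
  have h2 : Ideal.Quotient.mk P (τ • u) = Ideal.Quotient.mk P u ^ Nat.card (A ⧸ P.under A) :=
    hτ.mk_apply u
  have h3 : θ ⟨σ, hσ⟩ = Ideal.Quotient.mk P u := (hθ _ _).mp hu
  have := hθ.injective hP ht (a₁ := ⟨_, hc⟩)
    (a₂ := ⟨σ, hσ⟩ ^ Nat.card (A ⧸ P.under A)) (by rw [map_pow, h1, h2, h3])
  simpa using congrArg Subtype.val this

end TameInertia

/-! ### Generators of finite nilpotent groups -/

section Groups

theorem commutator_le_frattini {G : Type*} [Group G] [Finite G] [Group.IsNilpotent G] :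
    commutator G ≤ frattini G := by
  refine le_iInf₂ fun M hM ↦ ?_
  have hN : M.Normal :=
    Subgroup.NormalizerCondition.normal_of_coatom M Group.normalizerCondition_of_isNilpotent hM
  -- `M` and any element outside it generate `G`, so `G / M` is cyclic.
  obtain ⟨g, -, hg⟩ := SetLike.exists_of_lt hM.lt_top
  refine hN.commutator_le_of_self_sup_commutative_eq_top (H := Subgroup.zpowers g)
    (hM.2 _ (lt_of_le_of_ne le_sup_left fun h ↦ hg ?_)) inferInstance
  rw [h]
  exact Subgroup.mem_sup_right (Subgroup.mem_zpowers g)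

/-- Generating a finite nilpotent group modulo commutators is generating it. -/
theorem rank_le_card_of_closure_sup_commutator {G : Type*} [Group G] [Finite G]
    [Group.IsNilpotent G] (T : Finset G)
    (hT : Subgroup.closure (T : Set G) ⊔ commutator G = ⊤) : Group.rank G ≤ T.card := by
  refine Group.rank_le (frattini_nongenerating (top_le_iff.mp ?_))
  rw [← hT]
  exact sup_le_sup_left commutator_le_frattini _

end Groups

/-! ### Generation of the Galois group by inertia -/

section NumberField

variable {K : Type*} [Field K] [NumberField K] [IsGalois ℚ K]


instance faithfulSMul_gal_ringOfIntegers : FaithfulSMul Gal(K/ℚ) (𝓞 K) := IsGaloisGroup.faithful ℤ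

theorem card_inertia_eq (P : Ideal (𝓞 K)) [P.IsPrime] :
    Nat.card (P.inertia Gal(K/ℚ)) = P.ramificationIdx ℤ := by
  rw [Ideal.card_inertia_eq_ramificationIdxIn (P.under ℤ) P,
    Ideal.ramificationIdxIn_eq_ramificationIdx (P.under ℤ) P Gal(K/ℚ)]

/-- The Galois group of `K / ℚ` is generated by inertia: the fixed field of a subgroup containing all
inertia groups is unramified over `ℚ`, hence equal to `ℚ` by Minkowski's theorem. -/
theorem eq_top_of_inertia_le (H : Subgroup Gal(K/ℚ))
    (h : ∀ P : Ideal (𝓞 K), P.IsMaximal → P.inertia Gal(K/ℚ) ≤ H) : H = ⊤ := by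
  let F : IntermediateField ℚ K := FixedPoints.intermediateField H
  have : IsGaloisGroup H F K := IsGaloisGroup.subgroup Gal(K/ℚ) ℚ K H
  have : IsGaloisGroup H (𝓞 F) (𝓞 K) := IsGaloisGroup.of_isFractionRing H (𝓞 F) (𝓞 K) F K
  have hF : Module.finrank ℚ F = 1 := by
    by_contra hne
    obtain ⟨p, hp, hr⟩ := NumberField.exists_not_isUnramifiedAt_int (𝒪 := 𝓞 F) hne
    obtain ⟨P, hP, hPp⟩ := Ideal.exists_maximal_ideal_liesOver_of_isIntegral (S := 𝓞 K) p
    apply hr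
    rw [← Ideal.ramificationIdx_eq_one_iff]
    have h1 := card_inertia_eq P
    have h2 : Nat.card (P.inertia H) = P.ramificationIdx (𝓞 F) := by
      rw [Ideal.card_inertia_eq_ramificationIdxIn p P,
        Ideal.ramificationIdxIn_eq_ramificationIdx p P H]
    have h3 : Nat.card (P.inertia H) = Nat.card (P.inertia Gal(K/ℚ)) := by
      exact Nat.card_congr (Subgroup.subgroupOfEquivOfLe (h P hP)).toEquiv
    -- As the inertia group of `P` lies in `H`, `e(P | ℤ) = e(P | p)`; so `e(p | ℤ) = 1`.
    rw [Ideal.ramificationIdx_tower (R := ℤ) p P, ← h3, h2] at h1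
    have := Ideal.ramificationIdx_pos P (𝓞 F)
    exact (Nat.eq_of_mul_eq_mul_right this (by rw [one_mul]; exact h1)).symm
  have h4 := Module.finrank_mul_finrank ℚ F K
  rw [hF, one_mul, IsGaloisGroup.finrank_fixedPoints_eq_card_subgroup,
    ← IsGalois.card_aut_eq_finrank] at h4
  exact Subgroup.eq_top_of_card_eq H h4

end NumberField

/-! ### Tame extensions of the rationals -/

section TameExtension

open scoped commutatorElement

variable {K : Type} [Field K] [NumberField K] [IsGalois ℚ K]

theorem hasTameInertia_of_isTameOverRat (ht : IsTameOverRat K) {p : ℕ} (hp : p.Prime)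
    (P : Ideal (𝓞 K)) [P.IsPrime] [hPp : P.LiesOver (Ideal.span {(p : ℤ)})] :
    HasTameInertia Gal(K/ℚ) P := by
  intro σ hσ h
  refine ht p hp P inferInstance inferInstance ?_
  rw [← card_inertia_eq P]
  refine dvd_trans ?_ (Subgroup.orderOf_dvd_natCard _ hσ)
  have : ((orderOf σ : ℕ) : ℤ) ∈ P.under ℤ := by simpa using h
  rw [← hPp.over, Ideal.mem_span_singleton] at this
  exact_mod_cast this

theorem inertia_eq_bot_of_not_dvd {n : ℕ} (hu : UnramifiedOutside K n) {p : ℕ} (hp : p.Prime)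
    (hpn : ¬ p ∣ n) (P : Ideal (𝓞 K)) [P.IsPrime] [hPp : P.LiesOver (Ideal.span {(p : ℤ)})] :
    P.inertia Gal(K/ℚ) = ⊥ := by
  rw [← Subgroup.card_eq_one, card_inertia_eq]
  exact (hu p hp hpn).ramificationIdx_eq_one hPp

/-- Since the residue field below `P` has two elements, a Frobenius element `τ` at `P` satisfies
`τ σ τ⁻¹ = σ ^ 2` on inertia, so that `⁅τ, σ⁆ = σ`. -/
theorem inertia_le_commutator_of_liesOver_two (P : Ideal (𝓞 K)) [P.IsPrime] (hP : P ≠ ⊥)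
    [hP2 : P.LiesOver (Ideal.span {((2 : ℕ) : ℤ)})] (ht : HasTameInertia Gal(K/ℚ) P) :
    P.inertia Gal(K/ℚ) ≤ commutator Gal(K/ℚ) := by
  intro σ hσ
  have : Finite (𝓞 K ⧸ P) := Ring.HasFiniteQuotients.finiteQuotient hP
  obtain ⟨τ, hτ⟩ := IsArithFrobAt.exists_of_isInvariant ℤ Gal(K/ℚ) P
  have h := conj_eq_pow_of_isArithFrobAt hP ht hτ hσ
  rw [← hP2.over, Int.card_ideal_quot, pow_two] at h
  have : ⁅τ, σ⁆ = σ := by rw [commutatorElement_def, h, mul_inv_cancel_right]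
  rw [← this]
  exact Subgroup.commutator_mem_commutator (Subgroup.mem_top τ) (Subgroup.mem_top σ)

/-- One element for each odd prime `p ∣ n`, namely a generator of the inertia group at some prime
over `p`, is enough to generate the Galois group modulo commutators. -/
theorem exists_finset_closure_sup_commutator_eq_top {n : ℕ} (hn : n ≠ 0)
    (hu : UnramifiedOutside K n) (ht : IsTameOverRat K) :
    ∃ T : Finset Gal(K/ℚ), T.card ≤ (n.primeFactors.erase 2).card ∧
      Subgroup.closure (T : Set Gal(K/ℚ)) ⊔ commutator Gal(K/ℚ) = ⊤ := by
  classical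
  have hgen : ∀ p : ℕ, ∃ g : Gal(K/ℚ), p.Prime → ∃ P : Ideal (𝓞 K), P.IsMaximal ∧
      P.LiesOver (Ideal.span {(p : ℤ)}) ∧ P.inertia Gal(K/ℚ) = Subgroup.zpowers g := by
    intro p
    by_cases hp : p.Prime
    swap
    · exact ⟨1, fun h ↦ absurd h hp⟩
    have : Fact p.Prime := ⟨hp⟩
    obtain ⟨P, hP, hPp⟩ := Ideal.exists_maximal_ideal_liesOver_of_isIntegral (S := 𝓞 K)
      (Ideal.span {(p : ℤ)})
    have hP0 : P ≠ ⊥ := Ideal.IsMaximal.ne_bot_of_isIntegral_int P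
    obtain ⟨g, hg⟩ := (Subgroup.isCyclic_iff_exists_zpowers_eq_top _).mp
      (isCyclic_inertia hP0 (hasTameInertia_of_isTameOverRat ht hp P))
    exact ⟨g, fun _ ↦ ⟨P, hP, hPp, hg.symm⟩⟩
  choose g hg using hgen
  refine ⟨(n.primeFactors.erase 2).image g, Finset.card_image_le, ?_⟩
  set N := Subgroup.closure (((n.primeFactors.erase 2).image g : Finset Gal(K/ℚ)) : Set Gal(K/ℚ)) ⊔
    commutator Gal(K/ℚ)
  have hN : N.Normal := Subgroup.Normal.of_commutator_le _ le_sup_right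
  refine eq_top_of_inertia_le N fun Q hQ ↦ ?_
  have hQ0 : Q ≠ ⊥ := Ideal.IsMaximal.ne_bot_of_isIntegral_int Q
  obtain ⟨p, hp, hQp⟩ : ∃ p : ℕ, p.Prime ∧ Q.LiesOver (Ideal.span {(p : ℤ)}) := by
    have : NeZero Q := ⟨hQ0⟩
    exact ⟨_, Nat.absNorm_under_prime Q, Int.liesOver_span_absNorm Q⟩
  by_cases hpn : p ∣ n
  swap
  · rw [inertia_eq_bot_of_not_dvd hu hp hpn Q]
    exact bot_le
  by_cases hp2 : p = 2
  · subst hp2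
    exact (inertia_le_commutator_of_liesOver_two Q hQ0
      (hasTameInertia_of_isTameOverRat ht hp Q)).trans le_sup_right
  obtain ⟨P, hP, hPp, hPg⟩ := hg p hp
  have hgN : P.inertia Gal(K/ℚ) ≤ N := by
    rw [hPg, Subgroup.zpowers_le]
    refine Subgroup.mem_sup_left (Subgroup.subset_closure ?_)
    exact Finset.mem_coe.mpr (Finset.mem_image_of_mem g
      (Finset.mem_erase.mpr ⟨hp2, Nat.mem_primeFactors.mpr ⟨hp, hpn, hn⟩⟩))
  -- The inertia group at `Q` is conjugate to the one at the chosen prime `P`, and `N` is normal.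
  obtain ⟨τ, rfl⟩ := Ideal.exists_smul_eq_of_isGaloisGroup (Ideal.span {(p : ℤ)}) P Q Gal(K/ℚ)
  intro σ hσ
  have : τ⁻¹ * σ * τ⁻¹⁻¹ ∈ P.inertia Gal(K/ℚ) := fun x ↦ by
    have := Ideal.smul_mem_pointwise_smul τ⁻¹ _ _ (hσ (τ • x))
    rw [inv_smul_smul, smul_sub, inv_smul_smul] at this
    simpa only [mul_smul, inv_inv, Submodule.mem_toAddSubgroup] using this
  simpa [mul_assoc] using hN.conj_mem _ (hgN this) τ

end TameExtension

/-! ### The bound -/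

/-- The prime `2` has to be left out because `log 2 < 1`. -/
theorem card_erase_two_primeFactors_le_log {n : ℕ} (hn : n ≠ 0) :
    ((n.primeFactors.erase 2).card : ℝ) ≤ Real.log n := by
  have hpos : ∀ p ∈ n.primeFactors, 0 < (p : ℝ) := fun p hp ↦
    Nat.cast_pos.mpr (Nat.prime_of_mem_primeFactors hp).pos
  calc ((n.primeFactors.erase 2).card : ℝ) = ∑ p ∈ n.primeFactors.erase 2, (1 : ℝ) := by simp
    _ ≤ ∑ p ∈ n.primeFactors.erase 2, Real.log p := by
      refine Finset.sum_le_sum fun p hp ↦ ?_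
      obtain ⟨hp2, hp⟩ := Finset.mem_erase.mp hp
      have h3 : 3 ≤ p := by
        have := (Nat.prime_of_mem_primeFactors hp).two_le
        omega
      rw [Real.le_log_iff_exp_le (hpos p hp)]
      have : (3 : ℝ) ≤ p := by exact_mod_cast h3
      linarith [Real.exp_one_lt_d9]
    _ ≤ ∑ p ∈ n.primeFactors, Real.log p :=
      Finset.sum_le_sum_of_subset_of_nonneg (Finset.erase_subset _ _)
        fun p _ _ ↦ Real.log_natCast_nonneg p
    _ = Real.log ((∏ p ∈ n.primeFactors, p : ℕ) : ℝ) := by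
      rw [Nat.cast_prod, Real.log_prod fun p hp ↦ (hpos p hp).ne']
    _ ≤ Real.log n := by
      refine Real.log_le_log ?_ ?_
      · rw [Nat.cast_prod]
        exact Finset.prod_pos hpos
      · exact_mod_cast Nat.le_of_dvd (Nat.pos_of_ne_zero hn) (Nat.prod_primeFactors_dvd n)

theorem mainTheorem3 (n : ℕ) (hn : Squarefree n) (G : Type*) [Group G] [Finite G]
    (hG : IsTameGaloisGroup n G) (hnil : Group.IsNilpotent G) :
    (Group.rank G : ℝ) ≤ Real.log n := by
  obtain ⟨K, _, _, _, hu, ht, ⟨e⟩⟩ := hG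
  have : Group.IsNilpotent Gal(K/ℚ) := Group.nilpotent_of_mulEquiv e
  obtain ⟨T, hT, hT'⟩ := exists_finset_closure_sup_commutator_eq_top hn.ne_zero hu ht
  rw [Group.rank_congr e]
  calc (Group.rank Gal(K/ℚ) : ℝ) ≤ ((n.primeFactors.erase 2).card : ℝ) :=
        Nat.cast_le.mpr ((rank_le_card_of_closure_sup_commutator T hT').trans hT)
    _ ≤ Real.log n := card_erase_two_primeFactors_le_log hn.ne_zero
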